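/- **Setting.** Let $M,N\ge 1$ and $d\ge 0$ be integers. A dataset consists of samples $(x_{ij},y_{ij})\in\mathbb{R}^d\times\{+1,-1\}$, $1\le i\le M$ (compute nodes), $1\le j\le N$ (samples of node $i$). Put $C_i=\{w\in\mathbb{R}^d : y_{ij}x_{ij}^{T}w\ge 1 \text{ for } j=1,\dots,N\}$. The dataset is called *separable* if every $C_i$ is non-empty and $\bar C=\bigcap_{i=1}^M C_i\ne\emptyset$. For $\lambda>0$ the Local-GD iterates (local problems solved until convergence) are $w_0^0=0$ and $$w_i^{k+1}=\arg\min_{w\in\mathbb{R}^d}\Big[\sum_{j=1}^N \exp(-y_{ij}x_{ij}^{T}w)+\frac{\lambda}{2}\|w-w_0^k\|^2\Big],\qquad w_0^{k+1}=\frac1M\sum_{i=1}^M w_i^{k+1}.$$ The sequence obtained by averaging local max-margin projections (parallel projection method, PPM) is $\bar w_0^0=0$ and $$\bar w_i^{k+1}=\arg\min_{w\in C_i}\|w-\bar w_0^k\|,\qquad \bar w_0^{k+1}=\frac1M\sum_{i=1}^M \bar w_i^{k+1}.$$ **Claim.** Let the dataset be drawn from a continuous distribution, i.e. the joint law of the features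 $(x_{ij})$ is absolutely continuous with respect to Lebesgue measure on $(\mathbb{R}^d)^{MN}$ (the labels may depend on the features arbitrarily). Then almost surely, if the dataset is separable, the following hold. 1. There are $C$ and $\lambda_0>0$, depending on the dataset but not on $k$ or $\lambda$, such that for all $0<\lambda<\lambda_0$ and all $k\ge 0$, $$\Big\|w_0^k-\ln\big(\tfrac1\lambda\big)\,\bar w_0^k\Big\|\le C\,k\,\ln\ln\tfrac1\lambda .$$ 2. For every choice of rounds $k=k(\lambda)$ with $k(\lambda)\ge 1$ for all sufficiently small $\lambda$ and $k(\lambda)=o\big(\ln(1/\lambda)/\ln\ln(1/\lambda)\big)$ as $\lambda\to0^+$: for all sufficiently small $\lambda$ both $w_0^{k}$ and $\bar w_0^{k}$ are non-zero, and $$\frac{w_0^{k}}{\ln(1/\lambda)}-\bar w_0^{k}\to 0,\qquad \frac{w_0^{k}}{\|w_0^{k}\|}-\frac{\bar w_0^{k}}{\|\bar w_0^{k}\|}\to 0\qquad(\lambda\to 0^+).$$ 3. In particular, for every fixed $k\ge 1$: $\bar w_0^k\ne0$, $\ w_0^k/\ln(1/\lambda)\to\bar w_0^k\ $ and $\ \lim_{\lambda\to0^+}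 w_0^k/\|w_0^k\|=\bar w_0^k/\|\bar w_0^k\|$. -/

import Mathlib

open MeasureTheory Filter Topology Asymptotics

noncomputable section

namespace LocalGD

/-- A labelled dataset distributed over `M` compute nodes with `N` samples each: sample `j` of node
`i` is a pair `(x_{ij}, y_{ij})` with `x_{ij} ∈ ℝ^d` and `y_{ij} ∈ {+1, -1}`. -/
abbrev Dataset (d M N : ℕ) : Type := Fin M → Fin N → EuclideanSpace ℝ (Fin d) × ℤˣ

variable {d M N : ℕ}

/-- The features `(x_{ij})` of a dataset. -/
def features (S : Dataset d M N) : Fin M → Fin N → EuclideanSpace ℝ (Fin d) :=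
  fun i j => (S i j).1

theorem measurable_features : Measurable (features : Dataset d M N → _) := by
  unfold features
  fun_prop

/-- The datasets are sampled from a continuous distribution: the joint law of the features is
absolutely continuous with respect to Lebesgue measure (the labels may depend on the features
in any way). -/
def IsContinuousDistribution (μ : Measure (Dataset d M N)) : Prop :=
  (μ.map features) ≪ (volume : Measure (Fin M → Fin N → EuclideanSpace ℝ (Fin d)))

/-- The margin `y_{ij} x_{ij}ᵀ w` of the model `w` on sample `j` of node `i`. -/
def margin (S : Dataset d M N) (i : Fin M) (j : Fin N) (w : EuclideanSpace ℝ (Fin d)) : ℝ :=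
  (((S i j).2 : ℤ) : ℝ) * inner ℝ (S i j).1 w

/-- The local feasible set `C_i = {w | y_{ij} x_{ij}ᵀ w ≥ 1 for all j}`. -/
def feasibleSet (S : Dataset d M N) (i : Fin M) : Set (EuclideanSpace ℝ (Fin d)) :=
  {w | ∀ j, 1 ≤ margin S i j w}

/-- The datasets are locally and globally separable. -/
def Separable (S : Dataset d M N) : Prop :=
  (∀ i, (feasibleSet S i).Nonempty) ∧ (⋂ i, feasibleSet S i).Nonempty

/-- A minimizer of `f` over the set `s` (only used where there is exactly one). -/
def argminOn (f : EuclideanSpace ℝ (Fin d) → ℝ) (s : Set (EuclideanSpace ℝ (Fin d))) :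
    EuclideanSpace ℝ (Fin d) :=
  Classical.epsilon fun w => w ∈ s ∧ IsMinOn f s w

/-- The regularized exponential loss of node `i`,
`f_i(w) = ∑_j exp(-y_{ij} x_{ij}ᵀ w) + (lam / 2) ‖w - w₀‖²`. -/
def localLoss (S : Dataset d M N) (lam : ℝ) (i : Fin M) (w₀ w : EuclideanSpace ℝ (Fin d)) : ℝ :=
  ∑ j, Real.exp (-margin S i j w) + lam / 2 * ‖w - w₀‖ ^ 2

/-- The local model of node `i`, started at the global model `w₀` and trained until convergence:
the minimizer of its regularized loss. -/
def localUpdate (S : Dataset d M N) (lam : ℝ) (i : Fin M) (w₀ : EuclideanSpace ℝ (Fin d)) :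
    EuclideanSpace ℝ (Fin d) :=
  argminOn (localLoss S lam i w₀) Set.univ

/-- The global model of Local-GD after `k` rounds, with zero initialization. -/
def globalModel (S : Dataset d M N) (lam : ℝ) : ℕ → EuclideanSpace ℝ (Fin d)
  | 0 => 0
  | k + 1 => (1 / (M : ℝ)) • ∑ i, localUpdate S lam i (globalModel S lam k)

/-- The solution of the local max-margin problem of node `i`: the point `w` of `C_i` with the
smallest `‖w - w₀‖`. -/
def localMaxMargin (S : Dataset d M N) (i : Fin M) (w₀ : EuclideanSpace ℝ (Fin d)) :
    EuclideanSpace ℝ (Fin d) :=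
  argminOn (fun w => ‖w - w₀‖) (feasibleSet S i)

/-- The sequence obtained by averaging local max-margin solutions (parallel projection method),
with zero initialization. -/
def ppm (S : Dataset d M N) : ℕ → EuclideanSpace ℝ (Fin d)
  | 0 => 0
  | k + 1 => (1 / (M : ℝ)) • ∑ i, localMaxMargin S i (ppm S k)

/-- The direction of a vector (used for non-zero vectors). -/
def direction (w : EuclideanSpace ℝ (Fin d)) : EuclideanSpace ℝ (Fin d) := ‖w‖⁻¹ • w

/-! Well-definedness of the two minimizers. -/

theorem argminOn_spec {f : EuclideanSpace ℝ (Fin d) → ℝ} {s : Set (EuclideanSpace ℝ (Fin d))}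
    (h : ∃ w, w ∈ s ∧ IsMinOn f s w) : argminOn f s ∈ s ∧ IsMinOn f s (argminOn f s) :=
  Classical.epsilon_spec h

theorem continuous_margin (S : Dataset d M N) (i : Fin M) (j : Fin N) :
    Continuous (margin S i j) := by
  unfold margin
  fun_prop

theorem margin_midpoint (S : Dataset d M N) (i : Fin M) (j : Fin N)
    (a b : EuclideanSpace ℝ (Fin d)) :
    margin S i j ((2⁻¹ : ℝ) • (a + b)) = (margin S i j a + margin S i j b) / 2 := by
  simp only [margin, inner_smul_right, inner_add_right]
  ring

theorem norm_midpoint_sub_sq (a b c : EuclideanSpace ℝ (Fin d)) :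
    ‖(2⁻¹ : ℝ) • (a + b) - c‖ ^ 2 =
      (‖a - c‖ ^ 2 + ‖b - c‖ ^ 2) / 2 - ‖a - b‖ ^ 2 / 4 := by
  have h := parallelogram_law_with_norm ℝ (a - c) (b - c)
  have e1 : (2⁻¹ : ℝ) • (a + b) - c = (2⁻¹ : ℝ) • ((a - c) + (b - c)) := by
    module
  have e2 : (a - c) - (b - c) = a - b := by abel
  rw [e2] at h
  rw [e1, norm_smul, mul_pow]
  norm_num
  nlinarith

theorem localUpdate_isMin (S : Dataset d M N) {lam : ℝ} (hlam : 0 < lam) (i : Fin M)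
    (w₀ v : EuclideanSpace ℝ (Fin d)) :
    localLoss S lam i w₀ (localUpdate S lam i w₀) ≤ localLoss S lam i w₀ v := by
  have hc : Continuous (localLoss S lam i w₀) := by
    unfold localLoss
    have := continuous_margin S i
    fun_prop
  have ht : Tendsto (localLoss S lam i w₀) (cocompact _) atTop := by
    have h1 : Tendsto (fun w : EuclideanSpace ℝ (Fin d) => ‖w - w₀‖) (cocompact _) atTop := by
      simpa only [dist_eq_norm] using tendsto_dist_right_cocompact_atTop w₀
    have h2 := ((tendsto_pow_atTop (two_ne_zero)).comp h1).const_mul_atTop (half_pos hlam)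
    refine tendsto_atTop_mono (fun w => ?_) h2
    have : 0 ≤ ∑ j, Real.exp (-margin S i j w) :=
      Finset.sum_nonneg fun j _ => (Real.exp_pos _).le
    simp only [Function.comp, localLoss]
    linarith
  obtain ⟨w, hw⟩ := hc.exists_forall_le ht
  exact (argminOn_spec ⟨w, Set.mem_univ w, fun v _ => hw v⟩).2 (Set.mem_univ v)

theorem localUpdate_unique (S : Dataset d M N) {lam : ℝ} (hlam : 0 < lam) (i : Fin M)
    (w₀ w : EuclideanSpace ℝ (Fin d))
    (hw : ∀ v, localLoss S lam i w₀ w ≤ localLoss S lam i w₀ v) :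
    w = localUpdate S lam i w₀ := by
  set u := localUpdate S lam i w₀ with hu
  have h1 := hw ((2⁻¹ : ℝ) • (w + u))
  have h2 := localUpdate_isMin S hlam i w₀ ((2⁻¹ : ℝ) • (w + u))
  rw [← hu] at h2
  have h3 : ∑ j, Real.exp (-margin S i j ((2⁻¹ : ℝ) • (w + u))) ≤
      (∑ j, Real.exp (-margin S i j w) + ∑ j, Real.exp (-margin S i j u)) / 2 := by
    rw [← Finset.sum_add_distrib, Finset.sum_div]
    refine Finset.sum_le_sum fun j _ => ?_
    have := convexOn_exp.2 (Set.mem_univ (-margin S i j w)) (Set.mem_univ (-margin S i j u))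
      (by norm_num : (0 : ℝ) ≤ 2⁻¹) (by norm_num : (0 : ℝ) ≤ 2⁻¹) (by norm_num)
    simp only [smul_eq_mul] at this
    rw [margin_midpoint]
    calc _ = Real.exp (2⁻¹ * -margin S i j w + 2⁻¹ * -margin S i j u) := by congr 1; ring
      _ ≤ _ := this
      _ = _ := by ring
  simp only [localLoss] at h1 h2
  rw [norm_midpoint_sub_sq] at h1 h2
  have h4 : lam * ‖w - u‖ ^ 2 ≤ 0 := by nlinarith
  have h5 : ‖w - u‖ ^ 2 ≤ 0 := nonpos_of_mul_nonpos_right h4 hlam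
  have h6 : ‖w - u‖ = 0 := by nlinarith [norm_nonneg (w - u)]
  exact sub_eq_zero.1 (norm_eq_zero.1 h6)

theorem isClosed_feasibleSet (S : Dataset d M N) (i : Fin M) : IsClosed (feasibleSet S i) := by
  simp only [feasibleSet, Set.ofPred_forall]
  exact isClosed_iInter fun j => isClosed_le continuous_const (continuous_margin S i j)

theorem localMaxMargin_spec (S : Dataset d M N) (i : Fin M) (h : (feasibleSet S i).Nonempty)
    (w₀ : EuclideanSpace ℝ (Fin d)) :
    localMaxMargin S i w₀ ∈ feasibleSet S i ∧
      ∀ v ∈ feasibleSet S i, ‖localMaxMargin S i w₀ - w₀‖ ≤ ‖v - w₀‖ := by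
  obtain ⟨w, hw, hd⟩ := (isClosed_feasibleSet S i).exists_infDist_eq_dist h w₀
  refine argminOn_spec ⟨w, hw, fun v hv => ?_⟩
  have := Metric.infDist_le_dist_of_mem (x := w₀) hv
  rw [hd, dist_eq_norm, dist_eq_norm, norm_sub_rev, norm_sub_rev w₀ v] at this
  exact this

theorem localMaxMargin_unique (S : Dataset d M N) (i : Fin M) (w₀ w : EuclideanSpace ℝ (Fin d))
    (hw : w ∈ feasibleSet S i) (hmin : ∀ v ∈ feasibleSet S i, ‖w - w₀‖ ≤ ‖v - w₀‖) :
    w = localMaxMargin S i w₀ := by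
  obtain ⟨hu, humin⟩ := localMaxMargin_spec S i ⟨w, hw⟩ w₀
  set u := localMaxMargin S i w₀
  have hm : (2⁻¹ : ℝ) • (w + u) ∈ feasibleSet S i := fun j => by
    rw [margin_midpoint]
    linarith [hw j, hu j]
  have h1 := pow_le_pow_left₀ (norm_nonneg _) (hmin _ hm) 2
  have h2 := pow_le_pow_left₀ (norm_nonneg _) (humin _ hm) 2
  rw [norm_midpoint_sub_sq] at h1 h2
  have h6 : ‖w - u‖ = 0 := by nlinarith [norm_nonneg (w - u)]
  exact sub_eq_zero.1 (norm_eq_zero.1 h6)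

end LocalGD

end

/-!
Write `L = log (1 / lam)` and `a j = y j • x j`. After division by `lam`, the local problem of a node
started at `w₀` minimizes `∑ exp (L - ⟪a j, w⟫) + ‖w - w₀‖ ^ 2 / 2`, an exponential penalty for the
constraints `⟪a j, w⟫ ≥ L`, whereas the max-margin problem started at `u`, scaled by `L`, projects
`L • u` onto the polyhedron given by these constraints. The local update is a proximal map, so it is
nonexpansive in `w₀`, and the errors of successive rounds only add up. Everything reduces to the
estimate `exists_norm_penalty_sub_proj_le`: the penalized minimizer `p` started at `L • u` and the
projection `L • q` are `O(log L)` apart, uniformly for `u` in a bounded set.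

For this estimate let `μ j = exp (L - ⟪a j, p⟫)` and `L * ν j ≥ 0` be the multipliers of the two
problems. The difference of the two first-order conditions gives
`‖p - L • q‖ ^ 2 = ∑ (μ j - L * ν j) * (slack j p - slack j (L • q))`. By complementary slackness a
summand exceeds `1` only if `μ j < L * ν j`, and then by at most `3 log L * (L * ν j - μ j)`, because
comparing `p` with a feasible point shows that no constraint is violated by more than `3 log L`. As
`∑ ν j` is bounded, this already yields `‖p - L • q‖ = O(√(L log L)) = o(L)`, so that all constraints
with `ν j ≠ 0` or `μ j > 1` are almost active at `q`. Finitely many constraints that are almost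
active at a common point can be made active simultaneously (`exists_solvable_of_approx`), and by
general position their normals are then linearly independent. Hence each `L * ν j - μ j` is itself
`O(‖p - L • q‖ + 1)`, and the identity improves to `‖p - L • q‖ ^ 2 ≤ O(log L) * (‖p - L • q‖ + 1)`.
General position also provides the multipliers `ν` without Farkas' lemma (`exists_multipliers`).

General position, the only consequence of the continuity of the distribution that is used, holds
almost surely (`ae_generalPosition`): if the normals of a solvable system `⟪x j, w⟫ = ± 1` are
dependent, one of the `x j` lies on an affine hyperplane determined by the others and not through `0`.

The directions converge because the projection iterates stay away from `0` after the first round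
(`exists_le_norm_ppm`): they are closer to any common feasible point than `0` is.
-/

noncomputable section

namespace LocalGD

/-! ### Finite families of vectors -/

section Family

variable {ι E : Type*} [NormedAddCommGroup E] [InnerProductSpace ℝ E]

theorem exists_inner_eq_of_linearIndepOn {a : ι → E} {A : Finset ι}
    (h : LinearIndepOn ℝ a (A : Set ι)) (f : ι → ℝ) : ∃ w, ∀ j ∈ A, inner ℝ (a j) w = f j := by
  classical
  have hdet : (Matrix.gram ℝ fun j : A => a j).det ≠ 0 :=
    Matrix.det_gram_ne_zero_iff_linearIndependent.2 h
  set G := Matrix.gram ℝ fun j : A => a j with hG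
  have hu : IsUnit G.det := isUnit_iff_ne_zero.2 hdet
  refine ⟨∑ j : A, (G⁻¹.mulVec fun i : A => f i) j • a j, fun j hj => ?_⟩
  have h1 : G.mulVec (G⁻¹.mulVec fun i : A => f i) = fun i : A => f i := by
    rw [Matrix.mulVec_mulVec, Matrix.mul_nonsing_inv _ hu, Matrix.one_mulVec]
  have h2 := congrFun h1 ⟨j, hj⟩
  rw [← h2, inner_sum]
  simp only [Matrix.mulVec, dotProduct, inner_smul_right, hG, Matrix.gram_apply]
  exact Finset.sum_congr rfl fun i _ => mul_comm _ _

theorem exists_abs_coeff_le [Finite ι] (a : ι → E) :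
    ∃ K : ℝ, 0 ≤ K ∧ ∀ A : Finset ι, LinearIndepOn ℝ a (A : Set ι) → ∀ c : ι → ℝ, ∀ j ∈ A,
      |c j| ≤ K * ‖∑ i ∈ A, c i • a i‖ := by
  classical
  have key : ∀ (A : Finset ι) (j : ι), ∀ᶠ K : ℝ in atTop, LinearIndepOn ℝ a (A : Set ι) → j ∈ A →
      ∀ c : ι → ℝ, |c j| ≤ K * ‖∑ i ∈ A, c i • a i‖ := by
    intro A j
    by_cases h : LinearIndepOn ℝ a (A : Set ι)
    · -- pairing with a dual vector `w` extracts the coefficient `c j`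
      obtain ⟨w, hw⟩ := exists_inner_eq_of_linearIndepOn h (Pi.single j 1)
      filter_upwards [eventually_ge_atTop ‖w‖] with K hK _ hj c
      have h1 : inner ℝ (∑ i ∈ A, c i • a i) w = c j := by
        rw [sum_inner, Finset.sum_eq_single_of_mem j hj]
        · rw [real_inner_smul_left, hw j hj, Pi.single_eq_same, mul_one]
        · intro i hi hij
          rw [real_inner_smul_left, hw i hi, Pi.single_eq_of_ne hij, mul_zero]
      rw [← h1]
      refine (abs_real_inner_le_norm _ _).trans ?_
      rw [mul_comm]
      gcongr
    · exact Eventually.of_forall fun K hA => absurd hA h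
  have := Fintype.ofFinite ι
  obtain ⟨K, hK, hK0⟩ := ((eventually_all.2 fun A => eventually_all.2 (key A)).and
    (eventually_ge_atTop 0)).exists
  exact ⟨K, hK0, fun A hA c j hj => hK A j hA hj c⟩

/-- Approximately solvable systems `⟪a j, w⟫ = 1` are solvable: the range of a linear map into a
finite-dimensional space is closed. The tolerance is uniform over the finitely many subsystems. -/
theorem exists_solvable_of_approx [Finite ι] (a : ι → E) :
    ∃ ε : ℝ, 0 < ε ∧ ∀ (A : Finset ι) (w : E), (∀ j ∈ A, |inner ℝ (a j) w - 1| < ε) →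
      ∃ w', ∀ j ∈ A, inner ℝ (a j) w' = 1 := by
  have key : ∀ A : Finset ι, ∀ᶠ ε : ℝ in 𝓝[>] 0, ∀ w : E,
      (∀ j ∈ A, |inner ℝ (a j) w - 1| < ε) → ∃ w', ∀ j ∈ A, inner ℝ (a j) w' = 1 := by
    intro A
    by_cases h : ∃ w', ∀ j ∈ A, inner ℝ (a j) w' = 1
    · exact Eventually.of_forall fun _ _ _ => h
    let f : E →ₗ[ℝ] (A → ℝ) := LinearMap.pi fun j => (innerSL ℝ (a j)).toLinearMap
    have hf : ∀ w j, f w j = inner ℝ (a j) w := fun w j => rfl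
    have hcl : IsClosed (LinearMap.range f : Set (A → ℝ)) := Submodule.closed_of_finiteDimensional _
    have h1 : (fun _ => 1 : A → ℝ) ∈ (LinearMap.range f : Set (A → ℝ))ᶜ := by
      rintro ⟨w, hw⟩
      exact h ⟨w, fun j hj => by rw [← hf w ⟨j, hj⟩, hw]⟩
    obtain ⟨r, hr, hball⟩ := Metric.isOpen_iff.1 hcl.isOpen_compl _ h1
    filter_upwards [Ioo_mem_nhdsGT hr] with ε hε w hw
    exfalso
    refine hball (a := f w) ?_ ⟨w, rfl⟩
    rw [Metric.mem_ball, dist_pi_lt_iff hr]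
    intro j
    rw [Real.dist_eq, hf]
    exact (hw j j.2).trans hε.2
  have := Fintype.ofFinite ι
  obtain ⟨ε, hε, hε0⟩ := ((eventually_all.2 key).and self_mem_nhdsWithin).exists
  exact ⟨ε, hε0, hε⟩

end Family

/-! ### Projection onto a polyhedron -/

section Projection

variable {ι E : Type*} [NormedAddCommGroup E] [InnerProductSpace ℝ E]

theorem inner_nonneg_of_isMin {C : Set E} (hC : Convex ℝ C) {q w₀ : E} (hq : q ∈ C)
    (hmin : ∀ v ∈ C, ‖q - w₀‖ ≤ ‖v - w₀‖) {v : E} (hv : v ∈ C) : 0 ≤ inner ℝ (q - w₀) (v - q) := by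
  have : Nonempty C := ⟨⟨q, hq⟩⟩
  have h1 : ‖w₀ - q‖ = ⨅ w : C, ‖w₀ - w‖ := by
    refine le_antisymm (le_ciInf fun w => ?_) (ciInf_le ⟨0, ?_⟩ (⟨q, hq⟩ : C))
    · rw [norm_sub_rev, norm_sub_rev w₀]
      exact hmin w w.2
    · rintro _ ⟨w, rfl⟩
      exact norm_nonneg _
  have h2 := (norm_eq_iInf_iff_real_inner_le_zero hC hq).1 h1 v hv
  rw [← neg_sub w₀ q, inner_neg_left]
  linarith

theorem convex_polyhedron (a : ι → E) : Convex ℝ {w : E | ∀ j, 1 ≤ inner ℝ (a j) w} := by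
  intro x hx y hy s t hs ht hst j
  rw [inner_add_right, inner_smul_right, inner_smul_right]
  nlinarith [hx j, hy j]

/-- The Karush-Kuhn-Tucker conditions of the projection onto a polyhedron. Linear independence of
the active constraints replaces Farkas' lemma: the multipliers are read off with dual vectors. -/
theorem exists_multipliers [Fintype ι] (a : ι → E) {q w₀ : E} (hq : ∀ j, 1 ≤ inner ℝ (a j) q)
    (hmin : ∀ v, (∀ j, 1 ≤ inner ℝ (a j) v) → ‖q - w₀‖ ≤ ‖v - w₀‖)
    (hind : LinearIndepOn ℝ a {j | inner ℝ (a j) q = 1}) :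
    ∃ ν : ι → ℝ, (∀ j, 0 ≤ ν j) ∧ (∀ j, ν j ≠ 0 → inner ℝ (a j) q = 1) ∧
      q - w₀ = ∑ j, ν j • a j := by
  classical
  set A : Finset ι := {j | inner ℝ (a j) q = 1} with hA
  have hmem : ∀ j, j ∈ A ↔ inner ℝ (a j) q = 1 := by simp [hA]
  replace hind : LinearIndepOn ℝ a (A : Set ι) := by
    convert hind using 1
    ext j
    simp [hmem]
  have hdir : ∀ d : E, (∀ j ∈ A, 0 ≤ inner ℝ (a j) d) → 0 ≤ inner ℝ (q - w₀) d := by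
    intro d hd
    have hev : ∀ᶠ t : ℝ in 𝓝[>] 0, ∀ j, 1 ≤ inner ℝ (a j) (q + t • d) := by
      refine eventually_all.2 fun j => ?_
      by_cases hj : j ∈ A
      · filter_upwards [self_mem_nhdsWithin] with t ht
        rw [inner_add_right, inner_smul_right, (hmem j).1 hj]
        have := mul_nonneg (Set.mem_Ioi.1 ht).le (hd j hj)
        linarith
      · have hlt : 1 < inner ℝ (a j) q := lt_of_le_of_ne (hq j) fun h => hj ((hmem j).2 h.symm)
        have hc : Continuous fun t : ℝ => (inner ℝ (a j) (q + t • d) : ℝ) := by fun_prop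
        have h0 : (1 : ℝ) < inner ℝ (a j) (q + (0 : ℝ) • d) := by simpa using hlt
        filter_upwards [nhdsWithin_le_nhds (hc.continuousAt.eventually (lt_mem_nhds h0))] with t ht
        exact ht.le
    obtain ⟨t, ht, ht0⟩ := (hev.and self_mem_nhdsWithin).exists
    have h1 := inner_nonneg_of_isMin (convex_polyhedron a) hq hmin ht
    rw [add_sub_cancel_left, inner_smul_right] at h1
    exact nonneg_of_mul_nonneg_right h1 ht0
  choose e he using fun j : ι => exists_inner_eq_of_linearIndepOn hind (Pi.single j 1)
  refine ⟨fun j => if j ∈ A then inner ℝ (q - w₀) (e j) else 0, fun j => ?_, fun j hj => ?_, ?_⟩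
  · dsimp only
    split_ifs with hj
    · refine hdir _ fun i hi => ?_
      rw [he j i hi]
      by_cases hij : i = j
      · subst hij; simp
      · simp [hij]
    · exact le_rfl
  · by_contra h
    exact hj (if_neg fun hjA => h ((hmem j).1 hjA))
  · refine ext_inner_right ℝ fun d => ?_
    -- `d` minus its components along the dual vectors is orthogonal to every active normal
    set d' : E := d - ∑ j ∈ A, (inner ℝ (a j) d : ℝ) • e j with hd'
    have horth : ∀ i ∈ A, inner ℝ (a i) d' = 0 := by
      intro i hi
      rw [hd', inner_sub_right, inner_sum, Finset.sum_eq_single_of_mem i hi]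
      · rw [inner_smul_right, he i i hi, Pi.single_eq_same, mul_one, sub_self]
      · intro j _ hji
        rw [inner_smul_right, he j i hi, Pi.single_eq_of_ne hji.symm, mul_zero]
    have h1 := hdir d' fun i hi => (horth i hi).ge
    have h2 := hdir (-d') fun i hi => by rw [inner_neg_right, horth i hi, neg_zero]
    have h3 : inner ℝ (q - w₀) d' = 0 := by
      rw [inner_neg_right] at h2
      linarith
    rw [hd', inner_sub_right, inner_sum, sub_eq_zero] at h3
    rw [h3, sum_inner]
    simp only [ite_smul, zero_smul, inner_smul_right]
    rw [← Finset.sum_filter_add_sum_filter_not Finset.univ (· ∈ A)]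
    rw [Finset.sum_eq_zero (s := Finset.univ.filter (· ∉ A)), add_zero]
    · rw [Finset.filter_mem_eq_inter, Finset.univ_inter]
      refine Finset.sum_congr rfl fun j hj => ?_
      rw [if_pos hj, real_inner_smul_left, mul_comm]
    · intro j hj
      rw [if_neg (Finset.mem_filter.1 hj).2, inner_zero_left]

end Projection

/-! ### The exponential penalty versus the projection -/

section Penalty

variable {ι E : Type*} [NormedAddCommGroup E] [InnerProductSpace ℝ E]

/-- The contribution of one constraint to `‖p - L • q‖ ^ 2`: here `x` and `y` are the slacks at the
penalized and at the projected point, and `exp (-x)` and `n` the corresponding multipliers. -/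
theorem multiplier_sub_mul_slack_sub_le {x y n B : ℝ} (hy : 0 ≤ y) (hn : 0 ≤ n)
    (hny : n ≠ 0 → y = 0) (hx : -B ≤ x) :
    (Real.exp (-x) - n) * (x - y) ≤ 1 + B * max 0 (n - Real.exp (-x)) := by
  have hpos := Real.exp_pos (-x)
  rcases le_or_gt n (Real.exp (-x)) with h | h
  · rw [max_eq_left (by linarith), mul_zero, add_zero]
    rcases le_or_gt x y with hxy | hxy
    · nlinarith
    · have h1 : Real.exp (-x) * x ≤ 1 := by
        have h2 : Real.exp (-x) * Real.exp x = 1 := by rw [← Real.exp_add]; simp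
        nlinarith [Real.add_one_le_exp x]
      nlinarith
  · rw [max_eq_right (by linarith), hny (by linarith)]
    nlinarith

theorem le_of_sq_le_mul_add_one {t B l : ℝ} (hB : 1 ≤ B) (hl : 1 ≤ l) (h : t ^ 2 ≤ B * l * (t + 1)) :
    t ≤ (B + 1) * l := by
  by_contra! hlt
  have h1 : (B + 1) * l * t < t * t := by
    refine mul_lt_mul_of_pos_right hlt ?_
    nlinarith
  have h2 : (B + 1) * l ≤ l * t := by nlinarith
  nlinarith

/-- Minimizing the exponential penalty `∑ exp (L - ⟪a j, w⟫) + ‖w - L • u‖ ^ 2 / 2` differs from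
projecting `L • u` onto the polyhedron `⟪a j, w⟫ ≥ L` by `O(log L)`, uniformly for bounded `u`. -/
theorem exists_norm_penalty_sub_proj_le [Fintype ι] (a : ι → E) {v₀ : E}
    (hv₀ : ∀ j, 1 ≤ inner ℝ (a j) v₀)
    (hgen : ∀ A : Finset ι, (∃ w, ∀ j ∈ A, inner ℝ (a j) w = 1) → LinearIndepOn ℝ a (A : Set ι))
    (R : ℝ) :
    ∃ C : ℝ, ∀ᶠ L : ℝ in atTop, ∀ u q p : E, ‖u‖ ≤ R → (∀ j, 1 ≤ inner ℝ (a j) q) →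
      (∀ v, (∀ j, 1 ≤ inner ℝ (a j) v) → ‖q - u‖ ≤ ‖v - u‖) →
      (∀ j, L - 3 * Real.log L ≤ inner ℝ (a j) p) →
      p - L • u = ∑ j, Real.exp (L - inner ℝ (a j) p) • a j →
      ‖p - L • q‖ ≤ C * Real.log L := by
  classical
  obtain ⟨K, hK0, hK⟩ := exists_abs_coeff_le a
  obtain ⟨ε, hε, hsolv⟩ := exists_solvable_of_approx a
  set n : ℝ := ((Fintype.card ι : ℕ) : ℝ) with hn
  have hn0 : 0 ≤ n := by positivity
  set s : ℝ := ∑ j, ‖a j‖ with hs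
  have hs0 : 0 ≤ s := Finset.sum_nonneg fun _ _ => norm_nonneg _
  have has : ∀ j, ‖a j‖ ≤ s := fun j =>
    Finset.single_le_sum (f := fun j => ‖a j‖) (fun _ _ => norm_nonneg _) (Finset.mem_univ j)
  set D : ℝ := (‖v₀‖ + R) * ‖v₀‖ with hD
  set B : ℝ := n + 3 * n * K * (1 + s) + 1 with hB
  have hB1 : 1 ≤ B := by
    have : 0 ≤ 3 * n * K * (1 + s) := by positivity
    linarith
  have hsmall : ∀ᶠ L : ℝ in atTop, s ^ 2 * (n + 3 * Real.log L * (L * D)) < (ε * L) ^ 2 := by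
    have h1 : Tendsto (fun L : ℝ => Real.log L / L) atTop (𝓝 0) := by
      simpa using Real.tendsto_pow_log_div_mul_add_atTop 1 0 1 one_ne_zero
    have h2 : Tendsto (fun L : ℝ => (L ^ 2)⁻¹) atTop (𝓝 0) :=
      (tendsto_pow_atTop two_ne_zero).inv_tendsto_atTop
    have h3 := (h2.const_mul (s ^ 2 * n)).add (h1.const_mul (s ^ 2 * 3 * D))
    rw [mul_zero, mul_zero, add_zero] at h3
    filter_upwards [h3.eventually (gt_mem_nhds (by positivity : 0 < ε ^ 2)), eventually_gt_atTop 0]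
      with L hL hL0
    have h4 := mul_lt_mul_of_pos_right hL (by positivity : 0 < L ^ 2)
    calc _ = (s ^ 2 * n * (L ^ 2)⁻¹ + s ^ 2 * 3 * D * (Real.log L / L)) * L ^ 2 := by
          field_simp
      _ < _ := h4
      _ = _ := by ring
  refine ⟨B + 1, ?_⟩
  filter_upwards [hsmall, eventually_gt_atTop 0, Real.tendsto_log_atTop.eventually_ge_atTop 1]
    with L hL hL0 hl u q p hu hq hmin hp hstat
  have hind : LinearIndepOn ℝ a {j | inner ℝ (a j) q = 1} := by
    have h := hgen {j | inner ℝ (a j) q = 1} ⟨q, by simp⟩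
    simpa using h
  obtain ⟨ν, hν0, hνq, hνsum⟩ := exists_multipliers a hq hmin hind
  set l := Real.log L with hl_def
  set t := ‖p - L • q‖ with ht
  have ht0 : 0 ≤ t := norm_nonneg _
  set μ : ι → ℝ := fun j => Real.exp (L - inner ℝ (a j) p) with hμ
  have hμ0 : ∀ j, 0 ≤ μ j := fun j => (Real.exp_pos _).le
  have hdiff : p - L • q = ∑ j, (μ j - L * ν j) • a j := by
    calc p - L • q = (p - L • u) - L • (q - u) := by rw [smul_sub]; abel
      _ = _ := by
        rw [hstat, hνsum, Finset.smul_sum, ← Finset.sum_sub_distrib]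
        exact Finset.sum_congr rfl fun j _ => by rw [sub_smul, smul_smul]
  have hslack : ∀ j, (inner ℝ (a j) (p - L • q) : ℝ) =
      (inner ℝ (a j) p - L) - L * (inner ℝ (a j) q - 1) := fun j => by
    rw [inner_sub_right, inner_smul_right]; ring
  have hsq : t ^ 2 ≤ n + 3 * l * ∑ j, max 0 (L * ν j - μ j) := by
    calc t ^ 2 = inner ℝ (p - L • q) (p - L • q) := (real_inner_self_eq_norm_sq _).symm
      _ = ∑ j, (μ j - L * ν j) * ((inner ℝ (a j) p - L) - L * (inner ℝ (a j) q - 1)) := by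
        nth_rewrite 1 [hdiff]
        rw [sum_inner]
        exact Finset.sum_congr rfl fun j _ => by rw [real_inner_smul_left, hslack]
      _ ≤ ∑ j, (1 + 3 * l * max 0 (L * ν j - μ j)) := by
        refine Finset.sum_le_sum fun j _ => ?_
        have h1 : μ j = Real.exp (-(inner ℝ (a j) p - L)) := by rw [neg_sub]
        rw [h1]
        refine multiplier_sub_mul_slack_sub_le (mul_nonneg hL0.le (sub_nonneg.2 (hq j)))
          (mul_nonneg hL0.le (hν0 j)) (fun h => ?_) (by linarith [hp j])
        rw [hνq j (right_ne_zero_of_mul h), sub_self, mul_zero]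
      _ = _ := by
        rw [Finset.sum_add_distrib, Finset.mul_sum]
        simp [hn]
  -- a first bound `‖p - L • q‖ = O(√(L log L))`, enough to see that all relevant constraints are
  -- almost active at `q`
  have hcrude : t ^ 2 ≤ n + 3 * l * (L * D) := by
    refine hsq.trans ?_
    gcongr
    calc ∑ j, max 0 (L * ν j - μ j) ≤ ∑ j, L * (ν j * inner ℝ (a j) v₀) := by
          refine Finset.sum_le_sum fun j _ => ?_
          have h1 : ν j ≤ ν j * inner ℝ (a j) v₀ := le_mul_of_one_le_right (hν0 j) (hv₀ j)
          have h2 : L * ν j ≤ L * (ν j * inner ℝ (a j) v₀) := by gcongr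
          exact max_le (by nlinarith [mul_nonneg hL0.le (hν0 j)]) (by linarith [hμ0 j])
      _ = L * inner ℝ (q - u) v₀ := by
          rw [hνsum, sum_inner, Finset.mul_sum]
          exact Finset.sum_congr rfl fun j _ => by rw [real_inner_smul_left]
      _ ≤ L * D := by
          have h1 : ‖q - u‖ ≤ ‖v₀‖ + R :=
            (hmin v₀ hv₀).trans ((norm_sub_le _ _).trans (by linarith))
          have h2 := real_inner_le_norm (q - u) v₀
          have h3 : ‖q - u‖ * ‖v₀‖ ≤ D := by rw [hD]; gcongr
          gcongr
          linarith
  have hst : s * t < ε * L := by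
    refine lt_of_pow_lt_pow_left₀ 2 (by positivity) ?_
    calc (s * t) ^ 2 = s ^ 2 * t ^ 2 := mul_pow _ _ _
      _ ≤ s ^ 2 * (n + 3 * l * (L * D)) := by gcongr
      _ < _ := hL
  set A : Finset ι := {j | 1 < μ j ∨ ν j ≠ 0} with hA
  have hmemA : ∀ j, j ∈ A ↔ 1 < μ j ∨ ν j ≠ 0 := by simp [hA]
  have hAind : LinearIndepOn ℝ a (A : Set ι) := by
    refine hgen A (hsolv A q fun j hj => ?_)
    rcases (hmemA j).1 hj with h | h
    · have h1 : inner ℝ (a j) p < L := by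
        have := Real.one_lt_exp_iff.1 h
        linarith
      have h2 : (-inner ℝ (a j) (p - L • q) : ℝ) ≤ s * t :=
        ((neg_le_abs _).trans (abs_real_inner_le_norm _ _)).trans (by gcongr; exact has j)
      rw [hslack] at h2
      rw [abs_of_nonneg (sub_nonneg.2 (hq j))]
      nlinarith
    · rw [hνq j h, sub_self, abs_zero]
      exact hε
  have hrest : ‖∑ j ∈ A, (μ j - L * ν j) • a j‖ ≤ t + s := by
    have h1 : ∑ j ∈ A, (μ j - L * ν j) • a j =
        (p - L • q) - ∑ j ∈ Aᶜ, (μ j - L * ν j) • a j := by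
      rw [hdiff, ← Finset.sum_add_sum_compl A]; abel
    rw [h1]
    refine (norm_sub_le _ _).trans (add_le_add le_rfl ?_)
    refine (norm_sum_le _ _).trans ?_
    refine (Finset.sum_le_sum (g := fun j => ‖a j‖) fun j hj => ?_).trans
      (Finset.sum_le_univ_sum_of_nonneg fun _ => norm_nonneg _)
    have h2 := (hmemA j).not.1 (Finset.mem_compl.1 hj)
    push Not at h2
    rw [h2.2, mul_zero, sub_zero, norm_smul, Real.norm_of_nonneg (hμ0 j)]
    exact mul_le_of_le_one_left (norm_nonneg _) h2.1
  have hterm : ∀ j, max 0 (L * ν j - μ j) ≤ K * (t + s) := by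
    intro j
    refine max_le (by positivity) ?_
    by_cases hj : j ∈ A
    · calc L * ν j - μ j ≤ |μ j - L * ν j| := by rw [← neg_sub]; exact neg_le_abs _
        _ ≤ K * ‖∑ i ∈ A, (μ i - L * ν i) • a i‖ :=
          hK A hAind (fun j => μ j - L * ν j) j hj
        _ ≤ K * (t + s) := by gcongr
    · have h2 := (hmemA j).not.1 hj
      push Not at h2
      rw [h2.2, mul_zero, zero_sub]
      have : 0 ≤ K * (t + s) := by positivity
      linarith [hμ0 j]
  have hfin : t ^ 2 ≤ B * l * (t + 1) := by
    have h1 : ∑ j, max 0 (L * ν j - μ j) ≤ n * (K * (t + s)) := by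
      refine (Finset.sum_le_sum fun j _ => hterm j).trans ?_
      simp [hn]
    calc t ^ 2 ≤ n + 3 * l * (n * (K * (t + s))) := hsq.trans (by gcongr)
      _ ≤ n * l * (t + 1) + 3 * l * (n * (K * ((1 + s) * (t + 1)))) := by
        have h2 : n ≤ n * l * (t + 1) := by
          have : 1 ≤ l * (t + 1) := by nlinarith
          nlinarith
        have h3 : t + s ≤ (1 + s) * (t + 1) := by nlinarith
        have h4 : 3 * l * (n * (K * (t + s))) ≤ 3 * l * (n * (K * ((1 + s) * (t + 1)))) := by gcongr
        linarith
      _ ≤ B * l * (t + 1) := by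
        have : 0 ≤ l * (t + 1) := by positivity
        rw [hB]
        nlinarith
  exact le_of_sq_le_mul_add_one hB1 hl hfin

end Penalty

variable {d M N : ℕ}

/-! ### One round of Local-GD -/

/-- The signed feature `y_{ij} x_{ij}`, the normal vector of the `j`-th constraint of node `i`. -/
def normal (S : Dataset d M N) (i : Fin M) (j : Fin N) : EuclideanSpace ℝ (Fin d) :=
  (((S i j).2 : ℤ) : ℝ) • (S i j).1

theorem margin_eq_inner (S : Dataset d M N) (i : Fin M) (j : Fin N)
    (w : EuclideanSpace ℝ (Fin d)) : margin S i j w = inner ℝ (normal S i j) w := by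
  rw [margin, normal, real_inner_smul_left]

theorem mem_feasibleSet_iff {S : Dataset d M N} {i : Fin M} {w : EuclideanSpace ℝ (Fin d)} :
    w ∈ feasibleSet S i ↔ ∀ j, 1 ≤ inner ℝ (normal S i j) w := by
  simp only [← margin_eq_inner]
  rfl

theorem convex_feasibleSet (S : Dataset d M N) (i : Fin M) : Convex ℝ (feasibleSet S i) := by
  have h : feasibleSet S i = {w | ∀ j, 1 ≤ inner ℝ (normal S i j) w} :=
    Set.ext fun w => mem_feasibleSet_iff
  rw [h]
  exact convex_polyhedron _

/-- The first-order condition of the local problem. The factor `1 / lam` is absorbed into the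
exponentials as a shift of the margins by `log (1 / lam)`. -/
theorem localUpdate_sub_eq_sum (S : Dataset d M N) {lam : ℝ} (hlam : 0 < lam) (i : Fin M)
    (w₀ : EuclideanSpace ℝ (Fin d)) :
    localUpdate S lam i w₀ - w₀ = ∑ j, Real.exp (Real.log (1 / lam) -
      inner ℝ (normal S i j) (localUpdate S lam i w₀)) • normal S i j := by
  set p := localUpdate S lam i w₀ with hp
  refine ext_inner_right ℝ fun e => ?_
  set φ : ℝ → ℝ := fun t => localLoss S lam i w₀ (p + t • e) with hφ
  have hφ_eq : φ = fun t => ∑ j, Real.exp (-(inner ℝ (normal S i j) p +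
      t * inner ℝ (normal S i j) e)) + lam / 2 * (‖p - w₀‖ ^ 2 + 2 * (t * inner ℝ (p - w₀) e) +
      t ^ 2 * ‖e‖ ^ 2) := by
    funext t
    simp only [hφ, localLoss, margin_eq_inner]
    rw [add_sub_right_comm, norm_add_sq_real, norm_smul, mul_pow, Real.norm_eq_abs, sq_abs]
    simp only [inner_add_right, inner_smul_right]
  have hder : HasDerivAt φ (∑ j, Real.exp (-inner ℝ (normal S i j) p) *
      (-inner ℝ (normal S i j) e) + lam * inner ℝ (p - w₀) e) 0 := by
    rw [hφ_eq]
    have h1 : ∀ j ∈ (Finset.univ : Finset (Fin N)), HasDerivAt (fun t : ℝ =>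
        Real.exp (-(inner ℝ (normal S i j) p + t * inner ℝ (normal S i j) e)))
        (Real.exp (-inner ℝ (normal S i j) p) * (-inner ℝ (normal S i j) e)) 0 := by
      intro j _
      have := (((hasDerivAt_id (0 : ℝ)).mul_const (inner ℝ (normal S i j) e : ℝ)).const_add
        (inner ℝ (normal S i j) p : ℝ)).neg.exp
      simpa using this
    have h2 : HasDerivAt (fun t : ℝ => lam / 2 * (‖p - w₀‖ ^ 2 + 2 * (t * inner ℝ (p - w₀) e) +
        t ^ 2 * ‖e‖ ^ 2)) (lam * inner ℝ (p - w₀) e) 0 := by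
      have := (((((hasDerivAt_id (0 : ℝ)).mul_const (inner ℝ (p - w₀) e : ℝ)).const_mul 2).const_add
        (‖p - w₀‖ ^ 2)).add (((hasDerivAt_id (0 : ℝ)).pow 2).mul_const (‖e‖ ^ 2))).const_mul
        (lam / 2)
      refine this.congr_deriv ?_
      simp
      ring
    exact (HasDerivAt.fun_sum h1).add h2
  have hmin : IsLocalMin φ 0 := Eventually.of_forall fun t => by
    simp only [hφ, zero_smul, add_zero]
    exact localUpdate_isMin S hlam i w₀ _
  have h0 := hmin.hasDerivAt_eq_zero hder
  simp only [mul_neg, Finset.sum_neg_distrib] at h0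
  have hexp : ∀ x : ℝ, Real.exp (Real.log (1 / lam) - x) = lam⁻¹ * Real.exp (-x) := fun x => by
    rw [sub_eq_add_neg, Real.exp_add, Real.exp_log (by positivity), one_div]
  simp only [sum_inner, real_inner_smul_left, hexp, mul_assoc, ← Finset.mul_sum]
  rw [eq_inv_mul_iff_mul_eq₀ hlam.ne']
  linarith

/-- The local update is the proximal map of a convex function, hence nonexpansive. -/
theorem norm_localUpdate_sub_le (S : Dataset d M N) {lam : ℝ} (hlam : 0 < lam) (i : Fin M)
    (w w' : EuclideanSpace ℝ (Fin d)) :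
    ‖localUpdate S lam i w - localUpdate S lam i w'‖ ≤ ‖w - w'‖ := by
  have h := localUpdate_sub_eq_sum S hlam i w
  have h' := localUpdate_sub_eq_sum S hlam i w'
  set p := localUpdate S lam i w
  set p' := localUpdate S lam i w'
  set L := Real.log (1 / lam)
  have hmono : inner ℝ ((p - w) - (p' - w')) (p - p') ≤ (0 : ℝ) := by
    rw [h, h', ← Finset.sum_sub_distrib, sum_inner]
    refine Finset.sum_nonpos fun j _ => ?_
    rw [← sub_smul, real_inner_smul_left, inner_sub_right]
    rcases le_total (inner ℝ (normal S i j) p : ℝ) (inner ℝ (normal S i j) p') with hle | hle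
    · exact mul_nonpos_of_nonneg_of_nonpos
        (sub_nonneg.2 (Real.exp_le_exp.2 (by linarith))) (by linarith)
    · exact mul_nonpos_of_nonpos_of_nonneg
        (sub_nonpos.2 (Real.exp_le_exp.2 (by linarith))) (by linarith)
  have h1 : (p - w) - (p' - w') = (p - p') - (w - w') := by abel
  rw [h1, inner_sub_left, real_inner_self_eq_norm_sq] at hmono
  have h2 := real_inner_le_norm (w - w') (p - p')
  by_contra! hlt
  nlinarith [norm_nonneg (w - w')]

theorem tendsto_log_one_div_nhdsGT_zero :
    Tendsto (fun lam : ℝ => Real.log (1 / lam)) (𝓝[>] 0) atTop := by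
  simp only [one_div]
  exact Real.tendsto_log_atTop.comp tendsto_inv_nhdsGT_zero

theorem eventually_margin_localUpdate_ge (S : Dataset d M N) (i : Fin M)
    (hsep : (feasibleSet S i).Nonempty) (R : ℝ) :
    ∀ᶠ lam : ℝ in 𝓝[>] 0, ∀ u : EuclideanSpace ℝ (Fin d), ‖u‖ ≤ R → ∀ j,
      Real.log (1 / lam) - 3 * Real.log (Real.log (1 / lam)) ≤
        inner ℝ (normal S i j) (localUpdate S lam i (Real.log (1 / lam) • u)) := by
  obtain ⟨v₀, hv₀⟩ := hsep
  have hpoly : ∀ᶠ L : ℝ in atTop, (N : ℝ) + L ^ 2 * (‖v₀‖ + R) ^ 2 ≤ L ^ 3 := by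
    filter_upwards [eventually_ge_atTop ((N : ℝ) + (‖v₀‖ + R) ^ 2), eventually_ge_atTop 1]
      with L h1 h2
    have h3 : (N : ℝ) ≤ L ^ 2 * N := le_mul_of_one_le_left (Nat.cast_nonneg N) (by nlinarith)
    calc (N : ℝ) + L ^ 2 * (‖v₀‖ + R) ^ 2 ≤ L ^ 2 * (N + (‖v₀‖ + R) ^ 2) := by linarith
      _ ≤ L ^ 2 * L := by gcongr
      _ = L ^ 3 := by ring
  filter_upwards [tendsto_log_one_div_nhdsGT_zero.eventually hpoly,
    tendsto_log_one_div_nhdsGT_zero.eventually_gt_atTop 0, self_mem_nhdsWithin]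
    with lam hL hL0 hlam u hu j
  replace hlam : 0 < lam := hlam
  set L := Real.log (1 / lam) with hLdef
  have hexpL : Real.exp (-L) = lam := by
    rw [hLdef, one_div, Real.log_inv, neg_neg, Real.exp_log hlam]
  have hmin := localUpdate_isMin S hlam i (L • u) (L • v₀)
  set p := localUpdate S lam i (L • u)
  have h1 : Real.exp (-margin S i j p) ≤ localLoss S lam i (L • u) p := by
    have h2 := Finset.single_le_sum (f := fun j => Real.exp (-margin S i j p))
      (fun _ _ => (Real.exp_pos _).le) (Finset.mem_univ j)
    have h3 : 0 ≤ lam / 2 * ‖p - L • u‖ ^ 2 := by positivity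
    unfold localLoss
    linarith
  have h4 : localLoss S lam i (L • u) (L • v₀) ≤ lam * L ^ 3 := by
    have h5 : ∑ j, Real.exp (-margin S i j (L • v₀)) ≤ N * lam := by
      calc ∑ j, Real.exp (-margin S i j (L • v₀)) ≤ ∑ _j : Fin N, lam := by
            refine Finset.sum_le_sum fun j _ => ?_
            rw [← hexpL, Real.exp_le_exp, margin_eq_inner, inner_smul_right, neg_le_neg_iff]
            exact le_mul_of_one_le_right hL0.le (mem_feasibleSet_iff.1 hv₀ j)
        _ = N * lam := by simp
    have h6 : ‖L • v₀ - L • u‖ ≤ L * (‖v₀‖ + R) := by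
      rw [← smul_sub, norm_smul, Real.norm_of_nonneg hL0.le]
      gcongr
      exact (norm_sub_le _ _).trans (by linarith)
    have h7 : ‖L • v₀ - L • u‖ ^ 2 ≤ L ^ 2 * (‖v₀‖ + R) ^ 2 := by
      rw [← mul_pow]
      gcongr
    calc localLoss S lam i (L • u) (L • v₀)
        ≤ N * lam + lam / 2 * (L ^ 2 * (‖v₀‖ + R) ^ 2) := by unfold localLoss; gcongr
      _ ≤ N * lam + lam * (L ^ 2 * (‖v₀‖ + R) ^ 2) := by gcongr; linarith
      _ = lam * (N + L ^ 2 * (‖v₀‖ + R) ^ 2) := by ring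
      _ ≤ lam * L ^ 3 := by gcongr
  have h8 : Real.exp (-margin S i j p) ≤ Real.exp (-L + 3 * Real.log L) := by
    rw [Real.exp_add, hexpL, mul_comm 3, Real.exp_mul, Real.exp_log hL0]
    exact_mod_cast h1.trans (hmin.trans h4)
  rw [Real.exp_le_exp, margin_eq_inner] at h8
  linarith

/-- General position of the constraints of each node: constraints that can be active
simultaneously have linearly independent normals. -/
def GeneralPosition (S : Dataset d M N) : Prop :=
  ∀ (i : Fin M) (A : Finset (Fin N)), (∃ w, ∀ j ∈ A, inner ℝ (normal S i j) w = 1) →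
    LinearIndepOn ℝ (normal S i) (A : Set (Fin N))

/-- One local update follows one projection up to `O(log log (1 / lam))`. -/
theorem exists_norm_localUpdate_sub_le {S : Dataset d M N} (hgen : GeneralPosition S) (i : Fin M)
    (hsep : (feasibleSet S i).Nonempty) (R : ℝ) :
    ∃ C : ℝ, ∀ᶠ lam : ℝ in 𝓝[>] 0, ∀ u w : EuclideanSpace ℝ (Fin d), ‖u‖ ≤ R →
      ‖localUpdate S lam i w - Real.log (1 / lam) • localMaxMargin S i u‖ ≤
        ‖w - Real.log (1 / lam) • u‖ + C * Real.log (Real.log (1 / lam)) := by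
  obtain ⟨v₀, hv₀⟩ := id hsep
  obtain ⟨C, hC⟩ := exists_norm_penalty_sub_proj_le (normal S i) (mem_feasibleSet_iff.1 hv₀)
    (hgen i) R
  refine ⟨C, ?_⟩
  filter_upwards [tendsto_log_one_div_nhdsGT_zero.eventually hC,
    eventually_margin_localUpdate_ge S i hsep R, self_mem_nhdsWithin] with lam h1 h2 hlam u w hu
  obtain ⟨hq, hmin⟩ := localMaxMargin_spec S i hsep u
  have h3 := h1 u _ _ hu (mem_feasibleSet_iff.1 hq)
    (fun v hv => hmin v (mem_feasibleSet_iff.2 hv)) (h2 u hu)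
    (localUpdate_sub_eq_sum S hlam i _)
  exact (norm_sub_le_norm_sub_add_norm_sub _ _ _).trans
    (add_le_add (norm_localUpdate_sub_le S hlam i w _) h3)

/-! ### The parallel projection method -/

theorem norm_average_sub_le (hM : 0 < M) {f : Fin M → EuclideanSpace ℝ (Fin d)}
    {v : EuclideanSpace ℝ (Fin d)} {r : ℝ} (h : ∀ i, ‖f i - v‖ ≤ r) :
    ‖(1 / (M : ℝ)) • ∑ i, f i - v‖ ≤ r := by
  have hM' : (0 : ℝ) < M := Nat.cast_pos.2 hM
  have h1 : (1 / (M : ℝ)) • ∑ i, f i - v = (1 / (M : ℝ)) • ∑ i, (f i - v) := by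
    rw [Finset.sum_sub_distrib, smul_sub]
    simp only [Finset.sum_const, Finset.card_univ, Fintype.card_fin]
    rw [← Nat.cast_smul_eq_nsmul ℝ, smul_smul, one_div_mul_cancel hM'.ne', one_smul]
  rw [h1, norm_smul, Real.norm_of_nonneg (by positivity)]
  calc 1 / (M : ℝ) * ‖∑ i, (f i - v)‖ ≤ 1 / (M : ℝ) * (M * r) := by
        gcongr
        refine (norm_sum_le _ _).trans ((Finset.sum_le_sum fun i _ => h i).trans ?_)
        simp
    _ = r := by field_simp

theorem norm_localMaxMargin_sub_sq_le (S : Dataset d M N) (i : Fin M)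
    {v : EuclideanSpace ℝ (Fin d)} (hv : v ∈ feasibleSet S i) (u : EuclideanSpace ℝ (Fin d)) :
    ‖localMaxMargin S i u - v‖ ^ 2 + ‖localMaxMargin S i u - u‖ ^ 2 ≤ ‖u - v‖ ^ 2 := by
  obtain ⟨hq, hmin⟩ := localMaxMargin_spec S i ⟨v, hv⟩ u
  have h1 := inner_nonneg_of_isMin (convex_feasibleSet S i) hq hmin hv
  set q := localMaxMargin S i u
  have h2 : u - v = (q - v) - (q - u) := by abel
  have h3 : v - q = -(q - v) := by abel
  rw [h3, inner_neg_right, real_inner_comm] at h1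
  rw [h2, norm_sub_sq_real (q - v)]
  linarith

theorem norm_localMaxMargin_sub_le (S : Dataset d M N) (i : Fin M)
    {v : EuclideanSpace ℝ (Fin d)} (hv : v ∈ feasibleSet S i) (u : EuclideanSpace ℝ (Fin d)) :
    ‖localMaxMargin S i u - v‖ ≤ ‖u - v‖ := by
  refine le_of_sq_le_sq ?_ (norm_nonneg _)
  nlinarith [norm_localMaxMargin_sub_sq_le S i hv u, sq_nonneg ‖localMaxMargin S i u - u‖]

theorem antitone_norm_ppm_sub (hM : 0 < M) (S : Dataset d M N) {v : EuclideanSpace ℝ (Fin d)}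
    (hv : ∀ i, v ∈ feasibleSet S i) : Antitone fun k => ‖ppm S k - v‖ :=
  antitone_nat_of_succ_le fun _ =>
    norm_average_sub_le hM fun i => norm_localMaxMargin_sub_le S i (hv i) _

theorem norm_ppm_le (hM : 0 < M) (S : Dataset d M N) {v : EuclideanSpace ℝ (Fin d)}
    (hv : ∀ i, v ∈ feasibleSet S i) (k : ℕ) : ‖ppm S k‖ ≤ 2 * ‖v‖ := by
  have h1 := antitone_norm_ppm_sub hM S hv (Nat.zero_le k)
  have h2 : ‖ppm S 0 - v‖ = ‖v‖ := by simp [ppm]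
  simp only [h2] at h1
  have h3 := norm_sub_norm_le (ppm S k) v
  linarith

/-- After the first round the iterates are strictly closer than `0` to a common feasible point `v`,
because `0` is infeasible, and they never move away from `v` again. -/
theorem exists_le_norm_ppm (hM : 0 < M) (hN : 0 < N) (S : Dataset d M N)
    {v : EuclideanSpace ℝ (Fin d)} (hv : ∀ i, v ∈ feasibleSet S i) :
    ∃ c : ℝ, 0 < c ∧ ∀ k, 1 ≤ k → c ≤ ‖ppm S k‖ := by
  have hlt : ∀ i, ‖localMaxMargin S i 0 - v‖ < ‖v‖ := by
    intro i
    have h1 := norm_localMaxMargin_sub_sq_le S i (hv i) 0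
    have h2 : localMaxMargin S i 0 ≠ 0 := by
      intro h0
      have h3 := mem_feasibleSet_iff.1 (localMaxMargin_spec S i ⟨v, hv i⟩ 0).1 ⟨0, hN⟩
      rw [h0, inner_zero_right] at h3
      linarith
    rw [sub_zero, zero_sub, norm_neg] at h1
    have h4 := norm_pos_iff.2 h2
    refine lt_of_pow_lt_pow_left₀ 2 (norm_nonneg _) ?_
    nlinarith
  have : Nonempty (Fin M) := ⟨⟨0, hM⟩⟩
  obtain ⟨i₀, hi₀⟩ := Finite.exists_max fun i => ‖localMaxMargin S i 0 - v‖
  refine ⟨‖v‖ - ‖localMaxMargin S i₀ 0 - v‖, sub_pos.2 (hlt i₀), fun k hk => ?_⟩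
  have h1 : ‖ppm S k - v‖ ≤ ‖ppm S 1 - v‖ := antitone_norm_ppm_sub hM S hv hk
  have h2 : ‖ppm S 1 - v‖ ≤ ‖localMaxMargin S i₀ 0 - v‖ := norm_average_sub_le hM hi₀
  have h3 := norm_sub_norm_le v (ppm S k)
  rw [norm_sub_rev] at h3
  linarith

/-! ### Comparison of the two sequences -/

theorem exists_norm_globalModel_sub_le (hM : 0 < M) {S : Dataset d M N} (hgen : GeneralPosition S)
    (hsep : Separable S) :
    ∃ C : ℝ, ∀ᶠ lam : ℝ in 𝓝[>] 0, ∀ k : ℕ,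
      ‖globalModel S lam k - Real.log (1 / lam) • ppm S k‖
        ≤ C * ((k : ℝ) * Real.log (Real.log (1 / lam))) := by
  obtain ⟨hne, v, hv⟩ := hsep
  rw [Set.mem_iInter] at hv
  choose C hC using fun i => exists_norm_localUpdate_sub_le hgen i (hne i) (2 * ‖v‖)
  have : Nonempty (Fin M) := ⟨⟨0, hM⟩⟩
  obtain ⟨i₀, hi₀⟩ := Finite.exists_max C
  refine ⟨C i₀, ?_⟩
  filter_upwards [eventually_all.2 hC,
    (Real.tendsto_log_atTop.comp tendsto_log_one_div_nhdsGT_zero).eventually_ge_atTop 0]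
    with lam h hl k
  replace hl : 0 ≤ Real.log (Real.log (1 / lam)) := hl
  set L := Real.log (1 / lam)
  induction k with
  | zero => simp [globalModel, ppm]
  | succ k ih =>
    have hstep : ‖(1 / (M : ℝ)) • ∑ i, (localUpdate S lam i (globalModel S lam k) -
        L • localMaxMargin S i (ppm S k)) - 0‖ ≤
        C i₀ * (k * Real.log L) + C i₀ * Real.log L := by
      refine norm_average_sub_le hM fun i => ?_
      rw [sub_zero]
      refine (h i _ _ (norm_ppm_le hM S hv k)).trans (add_le_add ih ?_)
      exact mul_le_mul_of_nonneg_right (hi₀ i) hl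
    have h1 : globalModel S lam (k + 1) - L • ppm S (k + 1) =
        (1 / (M : ℝ)) • ∑ i, (localUpdate S lam i (globalModel S lam k) -
        L • localMaxMargin S i (ppm S k)) - 0 := by
      rw [globalModel, ppm, sub_zero, Finset.sum_sub_distrib, smul_sub, ← Finset.smul_sum,
        smul_comm L]
    rw [h1]
    refine hstep.trans (le_of_eq ?_)
    push_cast
    ring

theorem direction_smul {c : ℝ} (hc : 0 < c) (w : EuclideanSpace ℝ (Fin d)) :
    direction (c • w) = direction w := by
  rw [direction, direction, norm_smul, Real.norm_of_nonneg hc.le, smul_smul, mul_inv,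
    mul_right_comm, inv_mul_cancel₀ hc.ne', one_mul]

theorem norm_direction_sub_le (a : EuclideanSpace ℝ (Fin d)) {b : EuclideanSpace ℝ (Fin d)}
    (hb : b ≠ 0) : ‖direction a - direction b‖ ≤ 2 * ‖a - b‖ / ‖b‖ := by
  have hb' := norm_pos_iff.2 hb
  rw [le_div_iff₀ hb', mul_comm, ← norm_smul_of_nonneg hb'.le]
  have h1 : ‖b‖ • (direction a - direction b) = (‖b‖ - ‖a‖) • direction a + (a - b) := by
    have h2 : ‖b‖ • direction b = b := by
      rw [direction, smul_smul, mul_inv_cancel₀ hb'.ne', one_smul]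
    have h3 : ‖a‖ • direction a = a := by
      rcases eq_or_ne a 0 with rfl | ha
      · simp
      · rw [direction, smul_smul, mul_inv_cancel₀ (norm_ne_zero_iff.2 ha), one_smul]
    rw [smul_sub, h2, sub_smul, h3]
    abel
  have h4 : ‖direction a‖ ≤ 1 := by
    rw [direction, norm_smul, norm_inv, norm_norm]
    exact inv_mul_le_one
  rw [h1]
  calc _ ≤ ‖(‖b‖ - ‖a‖) • direction a‖ + ‖a - b‖ := norm_add_le _ _
    _ ≤ ‖a - b‖ * 1 + ‖a - b‖ := by
      rw [norm_smul]
      gcongr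
      rw [norm_sub_rev a b]
      exact abs_norm_sub_norm_le b a
    _ = 2 * ‖a - b‖ := by ring

theorem tendsto_globalModel_of_isLittleO (hM : 0 < M) (hN : 0 < N) {S : Dataset d M N}
    (hsep : Separable S)
    (hres : ∃ C : ℝ, ∀ᶠ lam : ℝ in 𝓝[>] 0, ∀ k : ℕ,
      ‖globalModel S lam k - Real.log (1 / lam) • ppm S k‖
        ≤ C * ((k : ℝ) * Real.log (Real.log (1 / lam))))
    (k : ℝ → ℕ) (hk1 : ∀ᶠ lam : ℝ in 𝓝[>] 0, 1 ≤ k lam)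
    (hk : (fun lam : ℝ => (k lam : ℝ)) =o[𝓝[>] 0]
      (fun lam : ℝ => Real.log (1 / lam) / Real.log (Real.log (1 / lam)))) :
    (∀ᶠ lam : ℝ in 𝓝[>] 0, globalModel S lam (k lam) ≠ 0 ∧ ppm S (k lam) ≠ 0) ∧
    Tendsto (fun lam : ℝ => (Real.log (1 / lam))⁻¹ • globalModel S lam (k lam)
      - ppm S (k lam)) (𝓝[>] 0) (𝓝 0) ∧
    Tendsto (fun lam : ℝ => direction (globalModel S lam (k lam))
      - direction (ppm S (k lam))) (𝓝[>] 0) (𝓝 0) := by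
  obtain ⟨-, v, hv⟩ := hsep
  rw [Set.mem_iInter] at hv
  obtain ⟨c, hc, hcle⟩ := exists_le_norm_ppm hM hN S hv
  obtain ⟨C, hC⟩ := hres
  have hL := tendsto_log_one_div_nhdsGT_zero
  have hl := Real.tendsto_log_atTop.comp hL
  have hratio : Tendsto (fun lam : ℝ => C * ((k lam : ℝ) /
      (Real.log (1 / lam) / Real.log (Real.log (1 / lam))))) (𝓝[>] 0) (𝓝 0) := by
    simpa using hk.tendsto_div_nhds_zero.const_mul C
  have h1 : Tendsto (fun lam : ℝ => (Real.log (1 / lam))⁻¹ • globalModel S lam (k lam)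
      - ppm S (k lam)) (𝓝[>] 0) (𝓝 0) := by
    refine squeeze_zero_norm' ?_ hratio
    filter_upwards [hC, hL.eventually_gt_atTop 0] with lam h hL0
    have h2 : (Real.log (1 / lam))⁻¹ • globalModel S lam (k lam) - ppm S (k lam) =
        (Real.log (1 / lam))⁻¹ • (globalModel S lam (k lam) -
          Real.log (1 / lam) • ppm S (k lam)) := by
      rw [smul_sub, smul_smul, inv_mul_cancel₀ hL0.ne', one_smul]
    rw [h2, norm_smul, Real.norm_of_nonneg (inv_nonneg.2 hL0.le)]
    calc _ ≤ (Real.log (1 / lam))⁻¹ * (C * (k lam * Real.log (Real.log (1 / lam)))) := by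
          gcongr
          exact h _
      _ = _ := by rw [div_div_eq_mul_div]; ring
  refine ⟨?_, h1, ?_⟩
  · filter_upwards [hk1, h1.norm.eventually (gt_mem_nhds (by simpa using hc))] with lam hk h2
    have h3 := hcle _ hk
    refine ⟨fun h0 => ?_, norm_pos_iff.1 (hc.trans_le h3)⟩
    rw [h0, smul_zero, zero_sub, norm_neg] at h2
    linarith
  · have h2 : Tendsto (fun lam : ℝ => 2 * ‖(Real.log (1 / lam))⁻¹ • globalModel S lam (k lam)
        - ppm S (k lam)‖ / c) (𝓝[>] 0) (𝓝 0) := by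
      simpa using (h1.norm.const_mul 2).div_const c
    refine squeeze_zero_norm' ?_ h2
    filter_upwards [hk1, hL.eventually_gt_atTop 0] with lam hk hL0
    have h3 := hcle _ hk
    rw [← direction_smul (inv_pos.2 hL0)]
    refine (norm_direction_sub_le _ (norm_pos_iff.1 (hc.trans_le h3))).trans ?_
    gcongr

theorem isLittleO_const_log_div_log_log (x : ℝ) :
    (fun _ : ℝ => x) =o[𝓝[>] 0]
      (fun lam : ℝ => Real.log (1 / lam) / Real.log (Real.log (1 / lam))) := by
  have h1 : Tendsto (fun L : ℝ => L / Real.log L) atTop atTop := by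
    have h2 : Tendsto (fun L : ℝ => Real.log L / L) atTop (𝓝[>] 0) := by
      refine tendsto_nhdsWithin_iff.2
        ⟨by simpa using Real.tendsto_pow_log_div_mul_add_atTop 1 0 1 one_ne_zero, ?_⟩
      filter_upwards [eventually_gt_atTop 1] with L hL
      exact div_pos (Real.log_pos hL) (by linarith)
    refine (tendsto_inv_nhdsGT_zero.comp h2).congr fun L => ?_
    simp
  exact isLittleO_const_left.2 (Or.inr
    (tendsto_norm_atTop_atTop.comp (h1.comp tendsto_log_one_div_nhdsGT_zero)))

/-! ### General position of continuous data -/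

/-- The vector in the span of `x b`, `b ∈ B`, whose inner products with the `x b` are `σ b` times
the Gram determinant, by Cramer's rule. It is polynomial in `x`, hence continuous. -/
def cramerVector {ι E : Type*} [DecidableEq ι] [NormedAddCommGroup E] [InnerProductSpace ℝ E]
    (x : ι → E) (B : Finset ι) (σ : ι → ℝ) : E :=
  ∑ b : B, ((Matrix.gram ℝ fun j : B => x j).adjugate.mulVec fun j : B => σ j) b • x b

theorem inner_cramerVector {ι E : Type*} [DecidableEq ι] [NormedAddCommGroup E]
    [InnerProductSpace ℝ E] (x : ι → E) (B : Finset ι) (σ : ι → ℝ) {b : ι} (hb : b ∈ B) :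
    inner ℝ (x b) (cramerVector x B σ) = (Matrix.gram ℝ fun j : B => x j).det * σ b := by
  set G := Matrix.gram ℝ fun j : B => x j with hG
  have h1 : G.mulVec (G.adjugate.mulVec fun j : B => σ j) = G.det • fun j : B => σ j := by
    rw [Matrix.mulVec_mulVec, Matrix.mul_adjugate, Matrix.smul_mulVec, Matrix.one_mulVec]
  have h2 := congrFun h1 ⟨b, hb⟩
  simp only [Pi.smul_apply, smul_eq_mul] at h2
  rw [← h2, cramerVector, inner_sum]
  simp only [Matrix.mulVec, dotProduct, inner_smul_right, hG, Matrix.gram_apply]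
  exact Finset.sum_congr rfl fun i _ => mul_comm _ _

/-- A solvable system `⟪x j, w⟫ = σ j` with dependent `x j` contains a maximal independent
subsystem `B` and a further equation, which then holds at the solution of `B` as well. -/
theorem exists_inner_cramerVector_eq {ι E : Type*} [DecidableEq ι] [NormedAddCommGroup E]
    [InnerProductSpace ℝ E] {x : ι → E} {A : Finset ι} {σ : ι → ℝ} {w : E}
    (hw : ∀ j ∈ A, inner ℝ (x j) w = σ j) (hdep : ¬ LinearIndepOn ℝ x (A : Set ι)) :
    ∃ (B : Finset ι) (j : ι), j ∉ B ∧ (Matrix.gram ℝ fun i : B => x i).det ≠ 0 ∧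
      inner ℝ (x j) (cramerVector x B σ) = (Matrix.gram ℝ fun i : B => x i).det * σ j := by
  obtain ⟨b, hbA, -, hspan, hb⟩ := exists_linearIndepOn_extension
    (linearIndepOn_empty ℝ x) (Set.empty_subset (A : Set ι))
  obtain ⟨B, rfl⟩ := (A.finite_toSet.subset hbA).exists_finset_coe
  obtain ⟨j, hjA, hjB⟩ : ∃ j ∈ A, j ∉ B := by
    by_contra! h
    exact hdep (hb.mono fun j hj => h j hj)
  refine ⟨B, j, hjB, Matrix.det_gram_ne_zero_iff_linearIndependent.2 hb, ?_⟩
  rw [← hw j hjA]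
  -- both sides are linear in `x j`, and they agree on `x b` for `b ∈ B`
  have hmem : x j ∈ Submodule.span ℝ (x '' B) := hspan ⟨j, hjA, rfl⟩
  generalize x j = z at hmem ⊢
  induction hmem using Submodule.span_induction with
  | mem y hy =>
    obtain ⟨b, hbB, rfl⟩ := hy
    rw [inner_cramerVector x B σ hbB, hw b (hbA hbB)]
  | zero => simp
  | add y z _ _ hy hz => rw [inner_add_left, inner_add_left, hy, hz, mul_add]
  | smul c y _ hy => rw [real_inner_smul_left, real_inner_smul_left, hy]; ring

theorem ae_inner_ne (v : EuclideanSpace ℝ (Fin d)) {c : ℝ} (hc : c ≠ 0)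
    (y : EuclideanSpace ℝ (Fin d)) :
    ∀ᵐ x : EuclideanSpace ℝ (Fin d), inner ℝ (y + x) v ≠ c := by
  let H : AffineSubspace ℝ (EuclideanSpace ℝ (Fin d)) :=
    { carrier := {x | inner ℝ (y + x) v = c}
      smul_vsub_vadd_mem' := by
        intro t p q r hp hq hr
        simp only [Set.mem_ofPred_eq, vsub_eq_sub, vadd_eq_add, inner_add_left, inner_sub_left,
          real_inner_smul_left] at hp hq hr ⊢
        linear_combination hr + t * (hp - hq) }
  have hH : H ≠ ⊤ := by
    intro h
    have h1 : -y ∈ H := h ▸ AffineSubspace.mem_top ℝ _ _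
    have h2 : inner ℝ (y + -y) v = c := h1
    rw [add_neg_cancel, inner_zero_left] at h2
    exact hc h2.symm
  have h0 := Measure.addHaar_affineSubspace volume H hH
  rw [ae_iff]
  simp only [ne_eq, not_not]
  exact h0

theorem ae_inner_cramerVector_ne (i : Fin M) (j : Fin N) {B : Finset (Fin N)} (hj : j ∉ B)
    {σ : Fin N → ℝ} (hσ : σ j ≠ 0) :
    ∀ᵐ x : Fin M → Fin N → EuclideanSpace ℝ (Fin d),
      (Matrix.gram ℝ fun b : B => x i b).det ≠ 0 →
      inner ℝ (x i j) (cramerVector (x i) B σ) ≠ (Matrix.gram ℝ fun b : B => x i b).det * σ j := by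
  have hG : Continuous fun x : Fin M → Fin N → EuclideanSpace ℝ (Fin d) =>
      Matrix.gram ℝ fun b : B => x i b :=
    continuous_matrix fun a b => by
      simp only [Matrix.gram_apply]
      fun_prop
  have hdet := hG.matrix_det
  have hvec : Continuous fun x : Fin M → Fin N → EuclideanSpace ℝ (Fin d) =>
      cramerVector (x i) B σ := by
    unfold cramerVector
    refine continuous_finsetSum _ fun b _ => ?_
    have h1 := (continuous_apply b).comp (hG.matrix_adjugate.matrix_mulVec
      (continuous_const (y := fun j : B => σ j)))
    exact h1.smul (by fun_prop)
  have hmeas : MeasurableSet {x : Fin M → Fin N → EuclideanSpace ℝ (Fin d) |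
      (Matrix.gram ℝ fun b : B => x i b).det ≠ 0 →
      inner ℝ (x i j) (cramerVector (x i) B σ) ≠
        (Matrix.gram ℝ fun b : B => x i b).det * σ j} := by
    have h1 : MeasurableSet {x : Fin M → Fin N → EuclideanSpace ℝ (Fin d) |
        (Matrix.gram ℝ fun b : B => x i b).det = 0} :=
      (isClosed_eq hdet continuous_const).measurableSet
    have h2 : MeasurableSet {x : Fin M → Fin N → EuclideanSpace ℝ (Fin d) |
        inner ℝ (x i j) (cramerVector (x i) B σ) =
          (Matrix.gram ℝ fun b : B => x i b).det * σ j} :=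
      (isClosed_eq (by fun_prop) (by fun_prop)).measurableSet
    convert h1.union h2.compl using 1
    ext x
    simp only [Set.mem_ofPred_eq, Set.mem_union, Set.mem_compl_iff]
    tauto
  -- it suffices to vary the single feature `x i j`, on which `cramerVector (x i) B σ` does not depend
  have hHaar : (volume : Measure (Fin M → Fin N → EuclideanSpace ℝ (Fin d))).IsAddHaarMeasure :=
    Measure.pi.isAddHaarMeasure _
  let T := (LinearMap.single ℝ (fun _ : Fin M => Fin N → EuclideanSpace ℝ (Fin d)) i).comp
    (LinearMap.single ℝ (fun _ : Fin N => EuclideanSpace ℝ (Fin d)) j)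
  refine ae_mem_of_ae_add_linearMap_mem T volume volume hmeas fun y => ?_
  have hTj : ∀ x, (y + T x) i j = y i j + x := fun x => by simp [T]
  have hTB : ∀ x, (fun b : B => (y + T x) i b) = fun b : B => y i b := fun x => by
    funext b
    have hne : (b : Fin N) ≠ j := fun h => hj (h ▸ b.2)
    simp [T, hne]
  have hvecT : ∀ x, cramerVector ((y + T x) i) B σ = cramerVector (y i) B σ := fun x => by
    unfold cramerVector
    rw [hTB]
    exact Finset.sum_congr rfl fun b _ => by rw [congrFun (hTB x) b]
  by_cases h0 : (Matrix.gram ℝ fun b : B => y i b).det = 0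
  · refine Eventually.of_forall fun x h => ?_
    rw [hTB] at h
    exact absurd h0 h
  · filter_upwards [ae_inner_ne (cramerVector (y i) B σ) (mul_ne_zero h0 hσ) (y i j)] with x hx
    intro _
    rw [hTB, hvecT, hTj]
    exact hx

theorem ae_generalPosition {μ : Measure (Dataset d M N)} (hμ : IsContinuousDistribution μ) :
    ∀ᵐ S ∂μ, GeneralPosition S := by
  have h1 : ∀ᵐ x : Fin M → Fin N → EuclideanSpace ℝ (Fin d),
      ∀ (i : Fin M) (j : Fin N) (B : Finset (Fin N)) (σ : Fin N → ℤˣ), j ∉ B →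
      (Matrix.gram ℝ fun b : B => x i b).det ≠ 0 →
      inner ℝ (x i j) (cramerVector (x i) B fun j => ((σ j : ℤ) : ℝ)) ≠
        (Matrix.gram ℝ fun b : B => x i b).det * ((σ j : ℤ) : ℝ) := by
    simp only [ae_all_iff]
    intro i j B σ hj
    exact ae_inner_cramerVector_ne i j hj (σ := fun j => ((σ j : ℤ) : ℝ))
      (Int.cast_ne_zero.2 (σ j).ne_zero)
  have h2 := ae_of_ae_map measurable_features.aemeasurable (hμ.ae_le h1)
  filter_upwards [h2] with S hS i A hA
  obtain ⟨w, hw⟩ := hA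
  have hsq : ∀ j, (((S i j).2 : ℤ) : ℝ) * (((S i j).2 : ℤ) : ℝ) = 1 := fun j => by
    rcases Int.units_eq_one_or (S i j).2 with h | h <;> simp [h]
  have hw' : ∀ j ∈ A, inner ℝ (features S i j) w = (((S i j).2 : ℤ) : ℝ) := by
    intro j hj
    have h3 := hw j hj
    rw [normal, real_inner_smul_left] at h3
    change inner ℝ (S i j).1 w = _
    linear_combination (((S i j).2 : ℤ) : ℝ) * h3 - inner ℝ (S i j).1 w * hsq j
  by_contra hdep
  have hdep' : ¬ LinearIndepOn ℝ (features S i) (A : Set (Fin N)) := by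
    intro h
    exact hdep (LinearIndependent.units_smul h
      fun j : (A : Set (Fin N)) => Units.map (Int.castRingHom ℝ).toMonoidHom (S i j).2)
  obtain ⟨B, j, hjB, hdet, heq⟩ := exists_inner_cramerVector_eq hw' hdep'
  exact hS i j B (fun j => (S i j).2) hjB hdet heq

end LocalGD

end

theorem lemma2 (d M N : ℕ) (hM : 0 < M) (hN : 0 < N)
    (μ : Measure (LocalGD.Dataset d M N)) [IsProbabilityMeasure μ]
    (hμ : LocalGD.IsContinuousDistribution μ) :
    ∀ᵐ S ∂μ, LocalGD.Separable S →
      -- the residual is `O(k ln ln (1/lam))`, uniformly in the round `k`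
      (∃ C : ℝ, ∀ᶠ lam : ℝ in 𝓝[>] 0, ∀ k : ℕ,
        ‖LocalGD.globalModel S lam k - Real.log (1 / lam) • LocalGD.ppm S k‖
          ≤ C * ((k : ℝ) * Real.log (Real.log (1 / lam)))) ∧
      -- for rounds `k = k(lam) ≥ 1` of order `o(ln (1/lam) / ln ln (1/lam))`, both models are
      -- eventually non-zero, they agree to leading order, and so do their directions
      (∀ k : ℝ → ℕ, (∀ᶠ lam : ℝ in 𝓝[>] 0, 1 ≤ k lam) →
        (fun lam : ℝ => (k lam : ℝ)) =o[𝓝[>] 0]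
          (fun lam : ℝ => Real.log (1 / lam) / Real.log (Real.log (1 / lam))) →
        (∀ᶠ lam : ℝ in 𝓝[>] 0,
          LocalGD.globalModel S lam (k lam) ≠ 0 ∧ LocalGD.ppm S (k lam) ≠ 0) ∧
        Tendsto (fun lam : ℝ => (Real.log (1 / lam))⁻¹ • LocalGD.globalModel S lam (k lam)
          - LocalGD.ppm S (k lam)) (𝓝[>] 0) (𝓝 0) ∧
        Tendsto (fun lam : ℝ => LocalGD.direction (LocalGD.globalModel S lam (k lam))
          - LocalGD.direction (LocalGD.ppm S (k lam))) (𝓝[>] 0) (𝓝 0)) ∧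
      -- in particular, for every fixed round `k ≥ 1`
      (∀ k : ℕ, 1 ≤ k →
        LocalGD.ppm S k ≠ 0 ∧
        Tendsto (fun lam : ℝ => (Real.log (1 / lam))⁻¹ • LocalGD.globalModel S lam k)
          (𝓝[>] 0) (𝓝 (LocalGD.ppm S k)) ∧
        Tendsto (fun lam : ℝ => LocalGD.direction (LocalGD.globalModel S lam k))
          (𝓝[>] 0) (𝓝 (LocalGD.direction (LocalGD.ppm S k)))) := by
  filter_upwards [LocalGD.ae_generalPosition hμ] with S hgen hsep
  have hres := LocalGD.exists_norm_globalModel_sub_le hM hgen hsep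
  have hlim := LocalGD.tendsto_globalModel_of_isLittleO hM hN hsep hres
  refine ⟨hres, hlim, fun k hk => ?_⟩
  obtain ⟨h1, h2, h3⟩ := hlim (fun _ => k) (Eventually.of_forall fun _ => hk)
    (LocalGD.isLittleO_const_log_div_log_log (k : ℝ))
  obtain ⟨_, -, h0⟩ := h1.exists
  exact ⟨h0, tendsto_sub_nhds_zero_iff.1 h2, tendsto_sub_nhds_zero_iff.1 h3⟩
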